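/- Let $\mathbb T=\mathbb R/\mathbb Z$, and for $k\in\mathbb Z$ let $T_k:\mathbb T\to\mathbb T$, $T_kx=kx \bmod 1$. For a Borel probability measure $\mu$ on $\mathbb T$ let $T_k\mu$ be the image measure, $T_k\mu(C)=\mu(T_k^{-1}C)$. Fix an integer $p\ge 2$, let $\mathcal P_p(\mathbb T)$ be the set of Borel probability measures $\mu$ on $\mathbb T$ with $T_p\mu=\mu$, endowed with the topology $w^*$ of weak-star convergence (against continuous functions on $\mathbb T$), and let $\mathcal P_{p,c}(\mathbb T)$ be the set of those $\mu\in\mathcal P_p(\mathbb T)$ that are continuous, i.e. have no atoms. Let $(c_n)_{n\ge 0}$ be a strictly increasing sequence of integers satisfying the following assumption (H): there exist finitely many nonnegative integers $t_1,\dots,t_r,h_1,\dots,h_d$, with $h_l\ne 0$ for every $l$, and an infinite set $I\subseteq\mathbb N$ such that for every $N\in I$ there exist $i\in\{1,\dots,r\}$ and $l\in\{1,\dots,d\}$ with $$h_l c_n\equiv t_i \pmod{p^N-1}\quad\text{for infinitely many } n.$$ Then the set $$G_{p,(c_n)}=\bigl\{\mu\in\mathcal P_{p,c}(\mathbb T)\;:\;T_{c_n}\mu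 \text{ does not converge } w^* \text{ to the normalised Lebesgue measure as } n\to\infty\bigr\}$$ is residual in $(\mathcal P_p(\mathbb T),w^*)$, i.e. it contains a countable intersection of dense open subsets of $\mathcal P_p(\mathbb T)$ (equivalently, since this space is compact and metrizable, a dense $G_\delta$ set). -/

import Mathlib

open MeasureTheory Filter Topology

noncomputable section

namespace TimesP

/-- The map `T_k : x ↦ k x mod 1` of the circle `𝕋 = ℝ / ℤ` into itself. -/
def mulMap (k : ℤ) : UnitAddCircle → UnitAddCircle := fun x => k • x

theorem measurable_mulMap (k : ℤ) : Measurable (mulMap k) :=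
  (continuous_zsmul k).measurable

/-- The image measure `T_k μ`, i.e. `C ↦ μ (T_k⁻¹ C)`. -/
def push (k : ℤ) (μ : ProbabilityMeasure UnitAddCircle) : ProbabilityMeasure UnitAddCircle :=
  μ.map (measurable_mulMap k).aemeasurable

/-- The normalised Lebesgue measure on the circle. -/
def leb : ProbabilityMeasure UnitAddCircle := ⟨volume, ⟨UnitAddCircle.measure_univ⟩⟩

/-- The set of `T_p`-invariant Borel probability measures on the circle. As a subtype of
`ProbabilityMeasure UnitAddCircle` it carries the topology of weak-star convergence. -/
def invariantMeasures (p : ℕ) : Set (ProbabilityMeasure UnitAddCircle) :=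
  {μ | push p μ = μ}

/-- Assumption (H) on the integer sequence `c`, relative to `p`. -/
def AssumptionH (p : ℕ) (c : ℕ → ℤ) : Prop :=
  ∃ (r d : ℕ) (t : Fin r → ℕ) (h : Fin d → ℕ) (I : Set ℕ),
    (∀ l, h l ≠ 0) ∧ I.Infinite ∧
      ∀ N ∈ I, ∃ (i : Fin r) (l : Fin d),
        {n : ℕ | (h l : ℤ) * c n ≡ (t i : ℤ) [ZMOD (p : ℤ) ^ N - 1]}.Infinite

/-- The set of continuous (non-atomic) `T_p`-invariant probability measures `μ` for which
`T_{c n} μ` does not converge weak-star to the Lebesgue measure. -/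
def nonEquidistributed (p : ℕ) (c : ℕ → ℤ) : Set (invariantMeasures p) :=
  {μ | (∀ x : UnitAddCircle, (μ.1 : Measure UnitAddCircle) {x} = 0) ∧
    ¬ Tendsto (fun n : ℕ => push (c n) μ.1) atTop (𝓝 leb)}

end TimesP

end

noncomputable section

namespace TimesP

open scoped ENNReal NNReal

/-! The proof is a Baire category argument on Fourier–Stieltjes coefficients. By pigeonhole (H)
yields one pair `h`, `t` serving infinitely many `N`. A residual set of measures is non-atomic, has
nonzero coefficient at `t`, and satisfies |μ^(h c_n)| > |μ^(t)|/2 for infinitely many n. As μ^(h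
c_n) is the `h`-th coefficient of T_{c_n} μ and Lebesgue measure has none at `h ≠ 0`, convergence
fails. Density rests on `exists_periodic_approximation`: round points to multiples of 1/(p^N - 1)
and average along orbits. On such measures frequencies matter only mod p^N - 1, so the coefficients
at h c_n and t agree exactly. Rounding away from fixed points gives orbits of length exactly N for
prime N, hence small atoms. -/

/-! ### Rounding to periodic points -/

/-- The point `1 / q` of the circle. -/
def unitFrac (q : ℕ) : UnitAddCircle := ((1 / q : ℝ) : UnitAddCircle)

theorem nsmul_unitFrac (k q : ℕ) : k • unitFrac q = ((k / q : ℝ) : UnitAddCircle) := by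
  rw [unitFrac, ← AddCircle.coe_nsmul, nsmul_eq_mul, mul_one_div]

theorem self_nsmul_unitFrac {q : ℕ} (hq : q ≠ 0) : q • unitFrac q = 0 := by
  rw [nsmul_unitFrac, div_self (by exact_mod_cast hq)]
  exact AddCircle.coe_period 1

theorem nsmul_unitFrac_ne_zero {k q : ℕ} (hk : 0 < k) (hkq : k < q) : k • unitFrac q ≠ 0 := by
  have hk' : (0 : ℝ) < k := by exact_mod_cast hk
  have hkq' : (k : ℝ) < q := by exact_mod_cast hkq
  rw [nsmul_unitFrac, Ne, AddCircle.coe_eq_zero_iff_of_mem_Ico]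
  · exact (div_pos hk' (hk'.trans hkq')).ne'
  · exact ⟨(div_pos hk' (hk'.trans hkq')).le, (div_lt_one (hk'.trans hkq')).2 hkq'⟩

theorem norm_coe_le_abs (y : ℝ) : ‖(y : UnitAddCircle)‖ ≤ |y| := by
  simpa using QuotientAddGroup.norm_mk_le_norm (S := AddSubgroup.zmultiples (1 : ℝ)) (m := y)

theorem nsmul_unitFrac_ne_self {p q : ℕ} (hp : 2 ≤ p) (hpq : p - 1 < q) :
    p • unitFrac q ≠ unitFrac q := by
  intro h
  refine nsmul_unitFrac_ne_zero (k := p - 1) (by omega) hpq ?_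
  obtain ⟨r, rfl⟩ : ∃ r, p = r + 1 := ⟨p - 1, by omega⟩
  rw [succ_nsmul] at h
  simpa using h

/-- Multiples of `1 / q`, with the fixed points of `x ↦ p x` replaced by their successors. -/
def nonfixedPoint (p q k : ℕ) : UnitAddCircle :=
  open Classical in
  if p • k • unitFrac q = k • unitFrac q then (k + 1) • unitFrac q else k • unitFrac q

/-- Two consecutive multiples of 1/q cannot both be fixed: their difference 1/q would be, but 0 < p
- 1 < q. -/
theorem nonfixedPoint_ne {p q : ℕ} (hp : 2 ≤ p) (hpq : p - 1 < q) (k : ℕ) :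
    p • nonfixedPoint p q k ≠ nonfixedPoint p q k := by
  unfold nonfixedPoint
  split_ifs with h
  · intro h'
    apply nsmul_unitFrac_ne_self hp hpq
    rw [succ_nsmul, nsmul_add, h] at h'
    exact add_left_cancel h'
  · exact h

theorem self_nsmul_nonfixedPoint (p : ℕ) {q : ℕ} (hq : q ≠ 0) (k : ℕ) :
    q • nonfixedPoint p q k = 0 := by
  unfold nonfixedPoint
  split_ifs <;> rw [← mul_nsmul, mul_nsmul', self_nsmul_unitFrac hq, nsmul_zero]

theorem dist_nonfixedPoint_le (p q k : ℕ) :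
    dist (nonfixedPoint p q k) (k • unitFrac q) ≤ 1 / q := by
  unfold nonfixedPoint
  split_ifs
  · rw [dist_eq_norm, succ_nsmul, add_sub_cancel_left, unitFrac]
    exact (norm_coe_le_abs _).trans_eq (abs_of_nonneg (by positivity))
  · simp only [dist_self]; positivity

/-- Rounding of the circle to points of period dividing `N` for `x ↦ p x`, avoiding its fixed
points. -/
theorem exists_rounding {p N : ℕ} (hp : 2 ≤ p) (hN : 2 ≤ N) :
    ∃ φ : UnitAddCircle → UnitAddCircle, Measurable φ ∧ (∀ x, (p ^ N - 1) • φ x = 0) ∧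
      (∀ x, p • φ x ≠ φ x) ∧ ∀ x, dist (φ x) x ≤ 2 / ((p : ℝ) ^ N - 1) := by
  set q := p ^ N - 1 with hq
  have hpN : p ^ 2 ≤ p ^ N := Nat.pow_le_pow_right (by omega) hN
  have hpq : p - 1 < q := by
    have : p * 2 ≤ p ^ 2 := by rw [sq]; exact Nat.mul_le_mul_left _ hp
    omega
  have hq0 : q ≠ 0 := by omega
  have hqr : ((p : ℝ) ^ N - 1) = q := by
    rw [hq, Nat.cast_sub (Nat.one_le_pow _ _ (by omega))]; simp
  have hqpos : (0 : ℝ) < q := by positivity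
  refine ⟨fun x => nonfixedPoint p q ⌊(q : ℝ) * (AddCircle.measurableEquivIco 1 0 x : ℝ)⌋₊,
    ?_, fun x => self_nsmul_nonfixedPoint p hq0 _, fun x => nonfixedPoint_ne hp hpq _, fun x => ?_⟩
  · have h1 : Measurable fun x : UnitAddCircle => (AddCircle.measurableEquivIco 1 0 x : ℝ) :=
      measurable_subtype_coe.comp (AddCircle.measurableEquivIco 1 0).measurable
    have h2 : Measurable (nonfixedPoint p q) := measurable_from_top
    exact h2.comp (Nat.measurable_floor.comp (h1.const_mul _))
  · rw [hqr]
    set y := AddCircle.measurableEquivIco 1 0 x with hy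
    have hyx : ((y : ℝ) : UnitAddCircle) = x := AddCircle.coe_equivIco (p := (1 : ℝ)) (a := 0)
    have hy0 : 0 ≤ (q : ℝ) * y := mul_nonneg hqpos.le y.2.1
    set k := ⌊(q : ℝ) * y⌋₊
    have h1 : (k : ℝ) ≤ q * y := Nat.floor_le hy0
    have h2 : (q : ℝ) * y < k + 1 := Nat.lt_floor_add_one _
    have h3 : dist (k • unitFrac q) x ≤ 1 / q := by
      rw [← hyx, nsmul_unitFrac, dist_eq_norm, ← AddCircle.coe_sub]
      refine (norm_coe_le_abs _).trans (abs_le.2 ⟨?_, ?_⟩)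
      · rw [← neg_div, div_sub' hqpos.ne']; gcongr; linarith
      · rw [div_sub' hqpos.ne']; gcongr; linarith
    calc _ ≤ _ := dist_triangle _ (k • unitFrac q) _
      _ ≤ 1 / q + 1 / q := add_le_add (dist_nonfixedPoint_le p q k) h3
      _ = 2 / q := by ring

/-! ### Orbit averages -/

/-- The average of the images of `μ` under `x ↦ p ^ j φ(x)`, `j < N`. -/
def orbitAverage (p N : ℕ) (φ : UnitAddCircle → UnitAddCircle) (μ : Measure UnitAddCircle) :
    Measure UnitAddCircle :=
  (N : ℝ≥0∞)⁻¹ • ∑ j ∈ Finset.range N, μ.map fun x => p ^ j • φ x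

theorem measurable_nsmul_circle (k : ℕ) : Measurable fun x : UnitAddCircle => k • x :=
  (continuous_nsmul k).measurable

section OrbitAverage

variable {p N : ℕ} {φ : UnitAddCircle → UnitAddCircle} {μ : Measure UnitAddCircle}

theorem orbitAverage_apply (hφ : Measurable φ) {s : Set UnitAddCircle} (hs : MeasurableSet s) :
    orbitAverage p N φ μ s
      = (N : ℝ≥0∞)⁻¹ * ∑ j ∈ Finset.range N, μ ((fun x => p ^ j • φ x) ⁻¹' s) := by
  simp only [orbitAverage, Measure.smul_apply, Measure.finsetSum_apply, smul_eq_mul]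
  congr 1
  exact Finset.sum_congr rfl fun j _ =>
    Measure.map_apply ((measurable_nsmul_circle _).comp hφ) hs

theorem isProbabilityMeasure_orbitAverage [IsProbabilityMeasure μ] (hN : N ≠ 0)
    (hφ : Measurable φ) : IsProbabilityMeasure (orbitAverage p N φ μ) := by
  refine ⟨?_⟩
  rw [orbitAverage_apply hφ MeasurableSet.univ]
  simp [ENNReal.inv_mul_cancel (Nat.cast_ne_zero.2 hN) (ENNReal.natCast_ne_top N)]

theorem map_nsmul_orbitAverage (hφ : Measurable φ) (hfix : ∀ x, p ^ N • φ x = φ x) :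
    (orbitAverage p N φ μ).map (fun x => p • x) = orbitAverage p N φ μ := by
  rcases N with _ | M
  · simp [orbitAverage]
  have hm : ∀ j, (μ.map fun x => p ^ j • φ x).map (fun x => p • x)
      = μ.map fun x => p ^ (j + 1) • φ x := fun j => by
    have hj : Measurable fun x => p ^ j • φ x := (measurable_nsmul_circle _).comp hφ
    rw [Measure.map_map (measurable_nsmul_circle p) hj]
    congr 1
    funext x
    simp only [Function.comp_apply, ← mul_nsmul, pow_succ]
  ext s hs
  rw [Measure.map_apply (measurable_nsmul_circle p) hs, orbitAverage]
  simp only [Measure.smul_apply, Measure.finsetSum_apply]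
  simp only [← Measure.map_apply (measurable_nsmul_circle p) hs, hm]
  rw [Finset.sum_range_succ, Finset.sum_range_succ' (fun j => (μ.map fun x => p ^ j • φ x) s)]
  simp [hfix]

theorem integral_orbitAverage {E : Type*} [NormedAddCommGroup E] [NormedSpace ℝ E]
    [IsProbabilityMeasure μ] (hφ : Measurable φ) (f : C(UnitAddCircle, E)) :
    ∫ x, f x ∂(orbitAverage p N φ μ)
      = (N : ℝ)⁻¹ • ∑ j ∈ Finset.range N, ∫ x, f (p ^ j • φ x) ∂μ := by
  have hm : ∀ j, Measurable fun x => p ^ j • φ x := fun j => (measurable_nsmul_circle _).comp hφ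
  rw [orbitAverage, integral_smul_measure, integral_finsetSum_measure]
  · simp only [ENNReal.toReal_inv, ENNReal.toReal_natCast]
    congr 1
    exact Finset.sum_congr rfl fun j _ => integral_map (hm j).aemeasurable
      f.continuous.aestronglyMeasurable
  · intro j _
    have := Measure.isProbabilityMeasure_map (μ := μ) (hm j).aemeasurable
    exact f.continuous.integrable_of_hasCompactSupport (HasCompactSupport.of_compactSpace f)

/-- Multiplication by p^j expands the rounding error by at most p^j. The geometric sum (p^N - 1)/(p
- 1) cancels the denominator, and averaging leaves O(1/N). -/
theorem abs_integral_orbitAverage_sub_le [IsProbabilityMeasure μ] (hp : 2 ≤ p) (hN : N ≠ 0)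
    (hφ : Measurable φ) {C : ℝ} (hd : ∀ x, dist (φ x) x ≤ C / ((p : ℝ) ^ N - 1))
    (hμ : μ.map (fun x => p • x) = μ) {f : C(UnitAddCircle, ℝ)} {K : ℝ≥0}
    (hf : LipschitzWith K f) :
    |∫ x, f x ∂(orbitAverage p N φ μ) - ∫ x, f x ∂μ| ≤ K * C / (p - 1) / N := by
  have hm : ∀ j, Measurable fun x => p ^ j • φ x := fun j => (measurable_nsmul_circle _).comp hφ
  have hmap : ∀ j, μ.map (fun x => p ^ j • x) = μ := fun j => by
    induction j with
    | zero => simp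
    | succ j ih =>
      conv_rhs => rw [← hμ, ← ih]
      rw [Measure.map_map (measurable_nsmul_circle _) (measurable_nsmul_circle _)]
      congr 1
      funext x
      simp only [Function.comp_apply, ← mul_nsmul, pow_succ]
  have hint : ∀ j, ∫ x, f (p ^ j • x) ∂μ = ∫ x, f x ∂μ := fun j => by
    conv_rhs => rw [← hmap j]
    exact (integral_map (measurable_nsmul_circle _).aemeasurable
      f.continuous.aestronglyMeasurable).symm
  have hbdd : ∀ g : UnitAddCircle → UnitAddCircle, Measurable g →
      Integrable (fun x => f (g x)) μ := fun g hg =>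
    Integrable.of_bound (f.continuous.measurable.comp hg).aestronglyMeasurable ‖f‖
      (Eventually.of_forall fun x => f.norm_coe_le_norm _)
  have hterm : ∀ j, |∫ x, f (p ^ j • φ x) ∂μ - ∫ x, f x ∂μ|
      ≤ K * C / ((p : ℝ) ^ N - 1) * (p : ℝ) ^ j := fun j => by
    rw [← hint j, ← integral_sub (hbdd _ (hm j)) (hbdd _ (measurable_nsmul_circle _)),
      ← Real.norm_eq_abs]
    refine (norm_integral_le_of_norm_le_const (C := K * C / ((p : ℝ) ^ N - 1) * (p : ℝ) ^ j)
      (Eventually.of_forall fun x => ?_)).trans_eq (by simp)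
    rw [← dist_eq_norm]
    refine (hf.dist_le_mul _ _).trans ?_
    rw [dist_eq_norm, ← nsmul_sub]
    have h1 := norm_nsmul_le (n := p ^ j) (a := φ x - x)
    have h2 := hd x
    rw [dist_eq_norm] at h2
    push_cast at h1
    calc (K : ℝ) * ‖p ^ j • (φ x - x)‖ ≤ K * ((p : ℝ) ^ j * (C / ((p : ℝ) ^ N - 1))) := by
          gcongr
          exact h1.trans (by gcongr)
      _ = _ := by ring
  have hp1 : (1 : ℝ) < p := by exact_mod_cast hp
  have hpN : (0 : ℝ) < (p : ℝ) ^ N - 1 := sub_pos.2 (one_lt_pow₀ hp1 hN)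
  have hp2 : (0 : ℝ) < (p : ℝ) - 1 := sub_pos.2 hp1
  have hN' : (0 : ℝ) < N := by positivity
  have hsplit : ∫ x, f x ∂(orbitAverage p N φ μ) - ∫ x, f x ∂μ
      = (N : ℝ)⁻¹ * ∑ j ∈ Finset.range N, (∫ x, f (p ^ j • φ x) ∂μ - ∫ x, f x ∂μ) := by
    rw [integral_orbitAverage hφ, Finset.sum_sub_distrib, mul_sub, smul_eq_mul]
    simp [hN]
  rw [hsplit, abs_mul, abs_of_pos (inv_pos.2 hN')]
  calc (N : ℝ)⁻¹ * |∑ j ∈ Finset.range N, (∫ x, f (p ^ j • φ x) ∂μ - ∫ x, f x ∂μ)|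
      ≤ (N : ℝ)⁻¹ * ∑ j ∈ Finset.range N, K * C / ((p : ℝ) ^ N - 1) * (p : ℝ) ^ j := by
        gcongr
        exact (Finset.abs_sum_le_sum_abs _ _).trans (Finset.sum_le_sum fun j _ => hterm j)
    _ = K * C / (p - 1) / N := by
        rw [← Finset.mul_sum, geom_sum_eq hp1.ne']
        field_simp

/-- For prime `N` every orbit met by the average has exactly `N` points, so its atoms are small. -/
theorem orbitAverage_singleton_le [IsProbabilityMeasure μ] (hN : N.Prime) (hφ : Measurable φ)
    (hfix : ∀ x, p ^ N • φ x = φ x) (hne : ∀ x, p • φ x ≠ φ x) (y : UnitAddCircle) :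
    orbitAverage p N φ μ {y} ≤ (N : ℝ≥0∞)⁻¹ := by
  have hm : ∀ j, Measurable fun x => p ^ j • φ x := fun j => (measurable_nsmul_circle _).comp hφ
  rw [orbitAverage_apply hφ (measurableSet_singleton y)]
  refine (mul_le_mul_right ?_ _).trans_eq (mul_one _)
  rw [← measure_biUnion_finset]
  · exact prob_le_one
  · have hiter : ∀ (j : ℕ) (z : UnitAddCircle), (fun x => p • x)^[j] z = p ^ j • z := fun j z => by
      induction j with
      | zero => simp
      | succ j ih => rw [Function.iterate_succ_apply', ih, ← mul_nsmul, pow_succ]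
    have key : ∀ i j, i < j → j < N → ∀ x, p ^ i • φ x ≠ p ^ j • φ x := by
      intro i j hij hj x h
      have hP : Function.IsPeriodicPt (fun x => p • x) N (φ x) := by
        rw [Function.IsPeriodicPt, Function.IsFixedPt, hiter, hfix]
      have hd : Function.IsPeriodicPt (fun x => p • x) (j - i) (φ x) := by
        rw [Function.IsPeriodicPt, Function.IsFixedPt, hiter]
        -- Moving on to time N turns the coincidence into period j - i, which is coprime to the
        -- prime N; so the point would be fixed.
        have h' := congrArg (fun z => p ^ (N - i) • z) h
        simp only [← mul_nsmul, ← pow_add] at h'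
        rw [show i + (N - i) = N by omega, show j + (N - i) = N + (j - i) by omega, hfix,
          pow_add, mul_nsmul, hfix] at h'
        exact h'.symm
      have hg := hP.gcd hd
      rw [show N.gcd (j - i) = 1 from Nat.coprime_of_lt_prime (by omega) (by omega) hN] at hg
      exact hne x hg
    intro i hi j hj hij
    rw [Finset.mem_coe, Finset.mem_range] at hi hj
    rw [Function.onFun, Set.disjoint_left]
    intro x hx hx'
    simp only [Set.mem_preimage, Set.mem_singleton_iff] at hx hx'
    rcases lt_or_gt_of_ne hij with h | h
    · exact key i j h hj x (hx.trans hx'.symm)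
    · exact key j i h hi x (hx'.trans hx.symm)
  · exact fun j _ => hm j (measurableSet_singleton y)

end OrbitAverage

/-! ### Approximation by periodic measures -/

theorem push_natCast_eq_iff {p : ℕ} {μ : ProbabilityMeasure UnitAddCircle} :
    push p μ = μ ↔ (μ : Measure UnitAddCircle).map (fun x => p • x) = μ := by
  have h : mulMap (p : ℤ) = fun x => p • x := funext fun x => natCast_zsmul x p
  rw [← h, ← ProbabilityMeasure.toMeasure_injective.eq_iff]
  rfl

/-- Every invariant measure is the limit of invariant measures `ν N`, where `ν N` is carried by the
points of period dividing `N` and, for prime `N`, has atoms of mass at most `1 / N`. -/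
theorem exists_periodic_approximation {p : ℕ} (hp : 2 ≤ p) (μ : invariantMeasures p) :
    ∃ ν : ℕ → invariantMeasures p, Tendsto ν atTop (𝓝 μ) ∧ ∀ N, 2 ≤ N →
      (∀ᵐ x ∂((ν N).1 : Measure UnitAddCircle), (p ^ N - 1) • x = 0) ∧
      (N.Prime → ∀ y, ((ν N).1 : Measure UnitAddCircle) {y} ≤ (N : ℝ≥0∞)⁻¹) := by
  have hμ := push_natCast_eq_iff.1 μ.2
  have hex : ∀ N : ℕ, ∃ ν : invariantMeasures p, 2 ≤ N →
      ((∀ᵐ x ∂(ν.1 : Measure UnitAddCircle), (p ^ N - 1) • x = 0) ∧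
      (N.Prime → ∀ y, (ν.1 : Measure UnitAddCircle) {y} ≤ (N : ℝ≥0∞)⁻¹)) ∧
      ∀ (f : C(UnitAddCircle, ℝ)) (K : ℝ≥0), LipschitzWith K f →
        |∫ x, f x ∂(ν.1 : Measure UnitAddCircle) - ∫ x, f x ∂(μ.1 : Measure UnitAddCircle)|
          ≤ K * 2 / (p - 1) / N := by
    intro N
    by_cases hN : 2 ≤ N
    swap
    · exact ⟨μ, fun h => absurd h hN⟩
    obtain ⟨φ, hφ, hz, hne, hd⟩ := exists_rounding hp hN
    have hfix : ∀ x, p ^ N • φ x = φ x := fun x => by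
      obtain ⟨r, hr⟩ : ∃ r, p ^ N = r + 1 :=
        ⟨p ^ N - 1, (Nat.sub_add_cancel (Nat.one_le_pow _ _ (by omega))).symm⟩
      have := hz x
      rw [hr, Nat.add_sub_cancel] at this
      rw [hr, succ_nsmul, this, zero_add]
    have hprob := isProbabilityMeasure_orbitAverage (p := p)
      (μ := (μ.1 : Measure UnitAddCircle)) (N := N) (by omega) hφ
    refine ⟨⟨⟨orbitAverage p N φ μ.1, hprob⟩,
      push_natCast_eq_iff.2 (map_nsmul_orbitAverage hφ hfix)⟩, fun _ => ⟨⟨?_, fun hNp y => ?_⟩, ?_⟩⟩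
    · have hs : MeasurableSet {x : UnitAddCircle | (p ^ N - 1) • x = 0}ᶜ :=
        (measurable_nsmul_circle (p ^ N - 1) (measurableSet_singleton 0)).compl
      change orbitAverage p N φ μ.1 {x | (p ^ N - 1) • x = 0}ᶜ = 0
      rw [orbitAverage_apply hφ hs]
      have : ∀ j, (fun x => p ^ j • φ x) ⁻¹' {x : UnitAddCircle | (p ^ N - 1) • x = 0}ᶜ = ∅ := by
        intro j
        ext x
        simp only [Set.preimage_compl, Set.mem_compl_iff, Set.mem_preimage, Set.mem_ofPred_eq,
          Set.mem_empty_iff_false, iff_false, not_not]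
        rw [nsmul_left_comm, hz, nsmul_zero]
      simp [this]
    · exact orbitAverage_singleton_le hNp hφ hfix hne y
    · exact fun f K hf => abs_integral_orbitAverage_sub_le hp (by omega) hφ hd hμ hf
  choose ν hν using hex
  refine ⟨ν, ?_, fun N hN => (hν N hN).1⟩
  rw [tendsto_subtype_rng, tendsto_iff_forall_lipschitz_integral_tendsto]
  rintro f - ⟨K, hf⟩
  rw [tendsto_iff_dist_tendsto_zero]
  refine squeeze_zero' (Eventually.of_forall fun _ => dist_nonneg) ?_
    (tendsto_const_div_atTop_nhds_zero_nat ((K : ℝ) * 2 / (p - 1)))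
  filter_upwards [eventually_ge_atTop 2] with N hN
  exact (hν N hN).2 ⟨f, hf.continuous⟩ K hf

/-! ### Non-atomic measures are residual -/

/-- By compactness the heavy atoms converge along the ultrafilter to some x. Closed balls about x
keep mass at least ε in the limit (portmanteau), and they shrink to x. -/
theorem isClosed_setOf_exists_le_singleton (ε : ℝ≥0∞) :
    IsClosed {μ : ProbabilityMeasure UnitAddCircle |
      ∃ x, ε ≤ (μ : Measure UnitAddCircle) {x}} := by
  rw [isClosed_iff_ultrafilter]
  intro μ u hu hmem
  have hex : ∀ ν : ProbabilityMeasure UnitAddCircle, ∃ x,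
      (∃ x, ε ≤ (ν : Measure UnitAddCircle) {x}) → ε ≤ (ν : Measure UnitAddCircle) {x} := by
    intro ν
    by_cases h : ∃ x, ε ≤ (ν : Measure UnitAddCircle) {x}
    · exact h.imp fun x hx _ => hx
    · exact ⟨0, fun h' => absurd h' h⟩
  choose X hX using hex
  obtain ⟨x, -, hx⟩ := isCompact_univ.ultrafilter_le_nhds (u.map X) (by simp)
  have hx : Tendsto X u (𝓝 x) := hx
  have hball : ∀ r > 0, ε ≤ (μ : Measure UnitAddCircle) (Metric.closedBall x r) := by
    intro r hr
    refine le_trans ?_ (ProbabilityMeasure.limsup_measure_closed_le_of_tendsto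
      (μs := id) (L := (u : Filter (ProbabilityMeasure UnitAddCircle))) hu
      (Metric.isClosed_closedBall (x := x) (ε := r)))
    refine le_limsup_of_frequently_le (Eventually.frequently ?_)
    filter_upwards [hmem, hx (Metric.closedBall_mem_nhds x hr)] with ν hν hν'
    exact (hX ν hν).trans (measure_mono (Set.singleton_subset_iff.2 hν'))
  refine ⟨x, ?_⟩
  have hlim := tendsto_measure_cthickening_of_isClosed (μ := (μ : Measure UnitAddCircle))
    (s := {x}) ⟨1, one_pos, measure_ne_top _ _⟩ isClosed_singleton
  refine ge_of_tendsto (hlim.mono_left (nhdsWithin_le_nhds (s := Set.Ioi 0))) ?_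
  filter_upwards [self_mem_nhdsWithin] with r hr
  rw [Metric.cthickening_singleton x (le_of_lt hr)]
  exact hball r hr

theorem nonatomic_mem_residual {p : ℕ} (hp : 2 ≤ p) :
    {μ : invariantMeasures p | ∀ x, (μ.1 : Measure UnitAddCircle) {x} = 0} ∈
      residual (invariantMeasures p) := by
  have hk : ∀ k : ℕ, {μ : invariantMeasures p |
      ¬ ∃ x, ((k : ℝ≥0∞) + 1)⁻¹ ≤ (μ.1 : Measure UnitAddCircle) {x}} ∈
        residual (invariantMeasures p) := by
    intro k
    refine residual_of_dense_open
      ((isClosed_setOf_exists_le_singleton _).isOpen_compl.preimage continuous_subtype_val) ?_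
    intro μ
    obtain ⟨ν, hν, hν'⟩ := exists_periodic_approximation hp μ
    refine mem_closure_of_frequently_of_tendsto ?_ hν
    refine frequently_atTop.2 fun a => ?_
    -- A prime N > k + 1 forces atoms of mass below 1/(k + 1).
    obtain ⟨N, hN, hNp⟩ := Nat.exists_infinite_primes (a + k + 2)
    refine ⟨N, by omega, ?_⟩
    rintro ⟨x, hx⟩
    have h := hx.trans ((hν' N hNp.two_le).2 hNp x)
    rw [ENNReal.inv_le_inv] at h
    have : N ≤ k + 1 := by exact_mod_cast h
    omega
  filter_upwards [countable_iInter_mem.2 hk] with μ hμ x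
  by_contra h0
  obtain ⟨k, hk⟩ := ENNReal.exists_inv_nat_lt h0
  refine Set.mem_iInter.1 hμ k ⟨x, (ENNReal.inv_le_inv.2 ?_).trans hk.le⟩
  exact le_self_add

/-! ### Fourier–Stieltjes coefficients -/

/-- The Fourier–Stieltjes coefficient `∫ e(k x) dμ(x)`. -/
def stieltjesCoeff (k : ℤ) (μ : ProbabilityMeasure UnitAddCircle) : ℂ :=
  ∫ x, fourier k x ∂(μ : Measure UnitAddCircle)

theorem continuous_stieltjesCoeff (k : ℤ) : Continuous (stieltjesCoeff k) :=
  continuous_iff_continuousAt.2 fun _ =>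
    (ProbabilityMeasure.tendsto_iff_forall_integral_rclike_tendsto ℂ).1 tendsto_id
      (BoundedContinuousFunction.mkOfCompact (fourier k))

theorem stieltjesCoeff_push (k m : ℤ) (μ : ProbabilityMeasure UnitAddCircle) :
    stieltjesCoeff k (push m μ) = stieltjesCoeff (k * m) μ := by
  change ∫ x, fourier k x ∂((μ : Measure UnitAddCircle).map (mulMap m)) = _
  rw [integral_map (measurable_mulMap m).aemeasurable
    (fourier k).continuous.aestronglyMeasurable, stieltjesCoeff]
  simp only [fourier_apply, mulMap, smul_smul]

theorem stieltjesCoeff_leb {k : ℤ} (hk : k ≠ 0) : stieltjesCoeff k leb = 0 := by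
  have h := fourierCoeff_fourier (T := (1 : ℝ)) k
  have h0 := congrFun h 0
  rw [Pi.single_eq_of_ne hk.symm, fourierCoeff, AddCircle.integral_haarAddCircle] at h0
  simpa [stieltjesCoeff, leb] using h0

theorem stieltjesCoeff_congr {q : ℕ} {k m : ℤ} {μ : ProbabilityMeasure UnitAddCircle}
    (hμ : ∀ᵐ x ∂(μ : Measure UnitAddCircle), q • x = 0) (h : k ≡ m [ZMOD q]) :
    stieltjesCoeff k μ = stieltjesCoeff m μ := by
  refine integral_congr_ae ?_
  filter_upwards [hμ] with x hx
  obtain ⟨r, hr⟩ := h.dvd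
  obtain rfl : m = k + r * q := by linarith
  rw [fourier_apply, fourier_apply, add_zsmul, mul_zsmul, natCast_zsmul, hx, zsmul_zero, add_zero]

/-- The convex combination `(1 - s) μ + s δ₀`. -/
def mixDirac (s : ℝ≥0) (μ : Measure UnitAddCircle) : Measure UnitAddCircle :=
  (1 - s) • μ + s • Measure.dirac 0

theorem isProbabilityMeasure_mixDirac {s : ℝ≥0} (hs : s ≤ 1) (μ : Measure UnitAddCircle)
    [IsProbabilityMeasure μ] : IsProbabilityMeasure (mixDirac s μ) := by
  refine ⟨?_⟩
  simp only [mixDirac, Measure.add_apply, Measure.smul_apply, measure_univ]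
  rw [← add_smul, tsub_add_cancel_of_le hs, one_smul]

theorem map_nsmul_mixDirac {p : ℕ} (s : ℝ≥0) {μ : Measure UnitAddCircle}
    (hμ : μ.map (fun x => p • x) = μ) :
    (mixDirac s μ).map (fun x => p • x) = mixDirac s μ := by
  rw [mixDirac, Measure.map_add _ _ (measurable_nsmul_circle p), Measure.map_smul,
    Measure.map_smul, hμ, Measure.map_dirac' (measurable_nsmul_circle p), nsmul_zero]

theorem integral_mixDirac {E : Type*} [NormedAddCommGroup E] [NormedSpace ℝ E] [CompleteSpace E]
    {s : ℝ≥0} (hs : s ≤ 1)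
    (μ : Measure UnitAddCircle) [IsProbabilityMeasure μ] {f : UnitAddCircle → E}
    (hf : Continuous f) :
    ∫ x, f x ∂(mixDirac s μ) = (1 - s : ℝ) • ∫ x, f x ∂μ + (s : ℝ) • f 0 := by
  have hint : ∀ ν : Measure UnitAddCircle, IsFiniteMeasure ν → Integrable f ν := fun ν _ =>
    hf.integrable_of_hasCompactSupport (HasCompactSupport.of_compactSpace f)
  rw [mixDirac, integral_add_measure (hint _ inferInstance) (hint _ inferInstance),
    integral_smul_nnreal_measure, integral_smul_nnreal_measure, integral_dirac,
    NNReal.smul_def, NNReal.smul_def, NNReal.coe_sub hs, NNReal.coe_one]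

/-- If the coefficient vanishes, mixing in mass s at the fixed point 0 makes it equal to s; let s =
1/(n + 1) → 0. -/
theorem dense_stieltjesCoeff_ne_zero (p : ℕ) (t : ℤ) :
    Dense {μ : invariantMeasures p | stieltjesCoeff t μ.1 ≠ 0} := by
  intro μ
  by_cases h0 : stieltjesCoeff t μ.1 = 0
  swap
  · exact subset_closure h0
  have hs : ∀ n : ℕ, ((n : ℝ≥0) + 1)⁻¹ ≤ 1 := fun n => inv_le_one_of_one_le₀ (by simp)
  let ν : ℕ → invariantMeasures p := fun n =>
    ⟨⟨mixDirac ((n : ℝ≥0) + 1)⁻¹ μ.1, isProbabilityMeasure_mixDirac (hs n) _⟩,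
      push_natCast_eq_iff.2 (map_nsmul_mixDirac _ (push_natCast_eq_iff.1 μ.2))⟩
  have hν : Tendsto ν atTop (𝓝 μ) := by
    rw [tendsto_subtype_rng, ProbabilityMeasure.tendsto_iff_forall_integral_tendsto]
    intro f
    have h1 : Tendsto (fun n : ℕ => (((n : ℝ≥0) + 1)⁻¹ : ℝ≥0)) atTop (𝓝 (0 : ℝ≥0)) := by
      simpa using tendsto_one_div_add_atTop_nhds_zero_nat (𝕜 := ℝ≥0)
    have h1' : Tendsto (fun n : ℕ => ((((n : ℝ≥0) + 1)⁻¹ : ℝ≥0) : ℝ)) atTop (𝓝 0) := 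
      NNReal.tendsto_coe.2 h1
    have h2 := ((tendsto_const_nhds (x := (1 : ℝ))).sub h1').smul_const
      (∫ x, f x ∂(μ.1 : Measure UnitAddCircle)) |>.add (h1'.smul_const (f 0))
    simp only [sub_zero, one_smul, zero_smul, add_zero] at h2
    exact h2.congr fun n => (integral_mixDirac (hs n) _ f.continuous).symm
  refine mem_closure_of_tendsto hν (Eventually.of_forall fun n => ?_)
  have h : stieltjesCoeff t (ν n).1 = _ := integral_mixDirac (hs n) _ (fourier t).continuous
  rw [stieltjesCoeff] at h0
  rw [Set.mem_ofPred_eq, h, h0, fourier_eval_zero, smul_zero, zero_add]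
  simpa using Nat.cast_add_one_ne_zero n

/-! ### Use of assumption (H) -/

theorem AssumptionH.exists_congr {p : ℕ} {c : ℕ → ℤ} (hH : AssumptionH p c) :
    ∃ h t : ℕ, h ≠ 0 ∧ {N : ℕ |
      {n : ℕ | (h : ℤ) * c n ≡ (t : ℤ) [ZMOD (p : ℤ) ^ N - 1]}.Infinite}.Infinite := by
  obtain ⟨r, d, t, h, I, hh, hI, hcong⟩ := hH
  have hsub : I ⊆ ⋃ a : Fin r × Fin d,
      {N : ℕ | {n : ℕ | (h a.2 : ℤ) * c n ≡ (t a.1 : ℤ) [ZMOD (p : ℤ) ^ N - 1]}.Infinite} :=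
    fun N hN => by
      obtain ⟨i, l, hil⟩ := hcong N hN
      exact Set.mem_iUnion.2 ⟨(i, l), hil⟩
  have hinf := hI.mono hsub
  by_contra! hcon
  refine hinf (Set.finite_iUnion fun a => ?_)
  simpa [Set.not_infinite] using hcon (h a.2) (t a.1) (hh a.2)

/-- It suffices to approximate μ with nonzero coefficient at `t`. Its periodic approximations
eventually share this, and for the N given by (H) the two coefficients coincide; the factor 1/2
makes the inequality strict, hence open. -/
theorem dense_exists_lt_norm_stieltjesCoeff {p : ℕ} (hp : 2 ≤ p) {c : ℕ → ℤ} {h t : ℕ}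
    (hI : {N : ℕ | {n : ℕ | (h : ℤ) * c n ≡ (t : ℤ) [ZMOD (p : ℤ) ^ N - 1]}.Infinite}.Infinite)
    (M : ℕ) : Dense {μ : invariantMeasures p | ∃ n ≥ M,
      ‖stieltjesCoeff t μ.1‖ / 2 < ‖stieltjesCoeff (h * c n) μ.1‖} := by
  refine Dense.of_closure ((dense_stieltjesCoeff_ne_zero p t).mono fun μ hμ => ?_)
  obtain ⟨ν, hν, hν'⟩ := exists_periodic_approximation hp μ
  have hcont := ((continuous_stieltjesCoeff t).comp continuous_subtype_val).tendsto μ |>.comp hν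
  refine mem_closure_of_frequently_of_tendsto ?_ hν
  have hfreq := Nat.frequently_atTop_iff_infinite.2 hI
  refine (hfreq.and_eventually
    ((eventually_ge_atTop 2).and (hcont.eventually_ne hμ))).mono ?_
  rintro N ⟨hN, hN2, hne⟩
  obtain ⟨n, hn, hMn⟩ := hN.exists_gt M
  refine ⟨n, hMn.le, ?_⟩
  have hcast : (((p ^ N - 1 : ℕ)) : ℤ) = (p : ℤ) ^ N - 1 := by
    rw [Nat.cast_sub (Nat.one_le_pow _ _ (by omega))]; simp
  have heq : stieltjesCoeff (h * c n) (ν N).1 = stieltjesCoeff t (ν N).1 :=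
    stieltjesCoeff_congr (hν' N hN2).1 (by rw [hcast]; exact hn)
  rw [heq]
  exact half_lt_self (norm_pos_iff.2 hne)

end TimesP

end

theorem theorem2p10 (p : ℕ) (hp : 2 ≤ p) (c : ℕ → ℤ) (hc : StrictMono c)
    (hH : TimesP.AssumptionH p c) :
    TimesP.nonEquidistributed p c ∈ residual (TimesP.invariantMeasures p) := by
  open TimesP in
  obtain ⟨h, t, hh, hI⟩ := hH.exists_congr
  have hcont : ∀ k : ℤ, Continuous fun μ : invariantMeasures p => stieltjesCoeff k μ.1 :=
    fun k => (continuous_stieltjesCoeff k).comp continuous_subtype_val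
  have hne := residual_of_dense_open (isOpen_ne_fun (hcont t) continuous_const)
    (dense_stieltjesCoeff_ne_zero p t)
  have hfar : ∀ M : ℕ, {μ : invariantMeasures p | ∃ n ≥ M,
      ‖stieltjesCoeff t μ.1‖ / 2 < ‖stieltjesCoeff (h * c n) μ.1‖} ∈
        residual (invariantMeasures p) := fun M => by
    refine residual_of_dense_open ?_ (dense_exists_lt_norm_stieltjesCoeff hp hI M)
    simp only [Set.ofPred_exists, Set.ofPred_and]
    exact isOpen_iUnion fun n => isOpen_const.inter
      (isOpen_lt ((hcont t).norm.div_const 2) (hcont _).norm)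
  filter_upwards [nonatomic_mem_residual hp, hne, countable_iInter_mem.2 hfar] with μ h1 h2 h3
  refine ⟨h1, fun hlim => ?_⟩
  have hl := (((continuous_stieltjesCoeff h).tendsto leb).comp hlim).norm
  rw [stieltjesCoeff_leb (by exact_mod_cast hh), norm_zero] at hl
  have hpos : 0 < ‖stieltjesCoeff t μ.1‖ / 2 := half_pos (norm_pos_iff.2 h2)
  obtain ⟨M, hM⟩ := eventually_atTop.1 (hl.eventually_lt_const hpos)
  obtain ⟨n, hn, hlt⟩ := Set.mem_iInter.1 h3 M
  have := hM n hn
  rw [Function.comp_apply, stieltjesCoeff_push] at this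
  exact lt_asymm hlt this
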